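/- Let $Q=(q_n)_{n\ge 1}$ be a sequence of integers $q_n\ge 2$ with $\lim_{n\to\infty} q_n=\infty$. For $x\in\mathbb{R}$ and $n\ge 0$ let $T_{Q,n}(x)\in[0,1)$ be the fractional part of $q_1q_2\cdots q_n\,x$ (so $T_{Q,0}(x)$ is the fractional part of $x$). An asymptotic distribution function (adf) is a non-decreasing function $f:[0,1]\to[0,1]$ with $f(0)=0$ and $f(1)=1$; a sequence $\omega=(\omega_i)_{i\ge 0}$ in $[0,1)$ has adf $f$ if $$\lim_{n\to\infty}\frac{\#\{0\le i<n:\ \omega_i\in[0,t)\}}{n}=f(t)\qquad\text{for every } t\in[0,1].$$ Then the set of all $x\in\mathbb{R}$ such that the sequence $(T_{Q,n}(x))_{n\ge 0}$ has no adf has Lebesgue measure zero and Hausdorff dimension $1$. -/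

import Mathlib

open Filter Topology MeasureTheory

namespace CantorSeries

/-- A basic sequence `Q = (q₁, q₂, …)` of integers `≥ 2`. The term `q_{k+1}` is stored
as `Q k`. -/
def IsBasicSequence (Q : ℕ → ℕ) : Prop :=
  ∀ k, 2 ≤ Q k

/-- `Q` is infinite in limit: `q_n → ∞`. -/
def InfiniteInLimit (Q : ℕ → ℕ) : Prop :=
  Tendsto Q atTop atTop

/-- `T_{Q,n}(x) = q_n q_{n-1} ⋯ q_1 x (mod 1)`, with values in `[0, 1)`; in particular
`T_{Q,0}(x) = x (mod 1)`. -/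
noncomputable def T (Q : ℕ → ℕ) (n : ℕ) (x : ℝ) : ℝ :=
  Int.fract ((∏ k ∈ Finset.range n, (Q k : ℝ)) * x)

open Classical in
/-- `A_n(I, ω)`: the number of the first `n` terms `ω 0, …, ω (n - 1)` of `ω` that lie in `I`. -/
noncomputable def countIn (I : Set ℝ) (ω : ℕ → ℝ) (n : ℕ) : ℕ :=
  ((Finset.range n).filter (fun i => ω i ∈ I)).card

/-- An asymptotic distribution function: a non-decreasing `f : [0,1] → [0,1]` with
`f 0 = 0` and `f 1 = 1`. -/
def IsADF (f : unitInterval → unitInterval) : Prop :=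
  Monotone f ∧ f 0 = 0 ∧ f 1 = 1

/-- The sequence `ω` has asymptotic distribution function `f`:
`A_n([0, t), ω) / n → f t` for every `t ∈ [0, 1]`. -/
def HasADF (ω : ℕ → ℝ) (f : unitInterval → unitInterval) : Prop :=
  IsADF f ∧ ∀ t : unitInterval,
    Tendsto (fun n : ℕ => (countIn (Set.Ico 0 (t : ℝ)) ω n : ℝ) / (n : ℝ)) atTop (𝓝 (f t : ℝ))

/-- The set of real `x` for which the sequence `(T_{Q,n}(x))_{n ≥ 0}` has no asymptotic
distribution function. -/
def noADFSet (Q : ℕ → ℕ) : Set ℝ :=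
  {x : ℝ | ¬ ∃ f : unitInterval → unitInterval, HasADF (fun n => T Q n x) f}

end CantorSeries

/-! Measure zero. Write P_n = q_1⋯q_n and c_t = 𝟙[{y} < t] - t. Since c_t has mean zero and a
bounded primitive, c_t(P_i x) and c_t(P_j x) with i ≤ j have correlation at most 2^{-(j-i)}, so the
discrepancy sum over n terms has second moment at most 3n. Along n = (m+1)^2 the normalized second
moments are summable. This gives convergence of frequencies almost everywhere along squares, and
monotonicity of counts fills the gaps. Using all rational t, almost every x has the identity as adf.

Dimension one. Restrict the n-th Cantor digit to about a quarter of its range, at the bottom when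
⌊log₂ n⌋ is even and from the middle when it is odd. Eventually T_n(x) < 1/3 exactly on the even
dyadic blocks, so the frequency of [0, 1/3) oscillates and no adf exists (`transfer_mem_noADFSet`).
These x are the image of [0, 1) under a map copying digits from a base m with q ≤ 8m. As q_n → ∞,
the factor 8 lost per digit is negligible against any power of q_n, so the inverse map is r-Hölder
for every r < 1 (`abs_sub_le_transfer`), which forces dimension at least 1. -/

namespace CantorSeries

/-! ### Correlations of centred indicators. -/

/-- The `1`-periodic function `𝟙[{y} < t] - t`. -/
noncomputable def centeredInd (t y : ℝ) : ℝ := (if Int.fract y < t then 1 else 0) - t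

theorem measurable_centeredInd (t : ℝ) : Measurable (centeredInd t) :=
  (Measurable.ite (measurableSet_lt measurable_fract measurable_const) measurable_const
    measurable_const).sub measurable_const

theorem periodic_centeredInd (t : ℝ) : Function.Periodic (centeredInd t) 1 := fun y => by
  simp [centeredInd]

theorem abs_centeredInd_le {t : ℝ} (h0 : 0 ≤ t) (h1 : t ≤ 1) (y : ℝ) :
    |centeredInd t y| ≤ 1 := by
  unfold centeredInd
  split_ifs <;> rw [abs_le] <;> constructor <;> linarith

theorem intervalIntegrable_of_abs_le {f : ℝ → ℝ} (hf : Measurable f) {C : ℝ}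
    (hC : ∀ x, |f x| ≤ C) (a b : ℝ) : IntervalIntegrable f volume a b := by
  rw [intervalIntegrable_iff]
  exact Measure.integrableOn_of_bounded (M := C) (by simp) hf.aestronglyMeasurable
    (Eventually.of_forall hC)

theorem intervalIntegrable_centeredInd {t : ℝ} (h0 : 0 ≤ t) (h1 : t ≤ 1) (a b : ℝ) :
    IntervalIntegrable (centeredInd t) volume a b :=
  intervalIntegrable_of_abs_le (measurable_centeredInd t) (abs_centeredInd_le h0 h1) a b

theorem integral_fract_lt_mul {t : ℝ} (h0 : 0 ≤ t) (h1 : t ≤ 1) (f : ℝ → ℝ) :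
    ∫ y in (0 : ℝ)..1, (if Int.fract y < t then f y else 0) = ∫ y in (0 : ℝ)..t, f y := by
  have : ∫ y in (0 : ℝ)..1, (if Int.fract y < t then f y else 0) =
      ∫ y in (0 : ℝ)..1, (Set.Ico 0 t).indicator f y := by
    refine intervalIntegral.integral_congr_ae ?_
    have : ∀ᵐ y : ℝ, y ≠ 1 := by simp [ae_iff]
    filter_upwards [this] with y hy hy'
    rw [Set.uIoc_of_le zero_le_one] at hy'
    have hy1 : y < 1 := lt_of_le_of_ne hy'.2 hy
    rw [Int.fract_eq_self.2 ⟨hy'.1.le, hy1⟩]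
    simp [Set.indicator, Set.mem_Ico, hy'.1.le]
  rw [this, intervalIntegral.integral_of_le zero_le_one, intervalIntegral.integral_of_le h0,
    integral_indicator measurableSet_Ico, Measure.restrict_restrict measurableSet_Ico]
  refine setIntegral_congr_set ?_
  have h2 : (Set.Ico 0 t ∩ Set.Ioc 0 1 : Set ℝ) =ᵐ[volume] (Set.Ioc 0 t ∩ Set.Ioc 0 1 : Set ℝ) :=
    Ico_ae_eq_Ioc.inter (ae_eq_refl _)
  rwa [Set.inter_eq_left.2 (Set.Ioc_subset_Ioc_right h1)] at h2

theorem integral_centeredInd {t : ℝ} (h0 : 0 ≤ t) (h1 : t ≤ 1) :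
    ∫ y in (0 : ℝ)..1, centeredInd t y = 0 := by
  have hi : IntervalIntegrable (fun y => if Int.fract y < t then (1 : ℝ) else 0) volume 0 1 := by
    refine intervalIntegrable_of_abs_le (C := 1) (Measurable.ite
      (measurableSet_lt measurable_fract measurable_const) measurable_const measurable_const) ?_ _ _
    intro x
    split_ifs <;> simp
  unfold centeredInd
  rw [intervalIntegral.integral_sub hi (by simp), integral_fract_lt_mul h0 h1]
  simp

/-- Full periods contribute nothing, so only the integral from ⌊y⌋ to y, of length less than 1,
remains. -/
theorem abs_integral_centeredInd_le {t : ℝ} (h0 : 0 ≤ t) (h1 : t ≤ 1) (y : ℝ) :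
    |∫ u in (0 : ℝ)..y, centeredInd t u| ≤ 1 := by
  have hI := intervalIntegrable_centeredInd h0 h1
  have h := (periodic_centeredInd t).intervalIntegral_add_zsmul_eq ⌊y⌋ 0 (fun a b => hI a b)
  have e0 : ∫ u in (0 : ℝ)..0 + 1, centeredInd t u = 0 := by
    rw [zero_add]; exact integral_centeredInd h0 h1
  rw [e0] at h
  simp only [zsmul_eq_mul, mul_one, zero_add, mul_zero] at h
  rw [← intervalIntegral.integral_add_adjacent_intervals (hI 0 ⌊y⌋) (hI ⌊y⌋ y), h, zero_add]
  have := intervalIntegral.norm_integral_le_of_norm_le_const (a := (⌊y⌋ : ℝ)) (b := y) (C := 1)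
    (f := centeredInd t) (fun u _ => abs_centeredInd_le h0 h1 u)
  rw [Real.norm_eq_abs, one_mul, abs_of_nonneg (sub_nonneg.2 (Int.floor_le y))] at this
  linarith [Int.lt_floor_add_one y]

theorem integral_comp_natCast_mul_of_periodic {f : ℝ → ℝ} (hp : Function.Periodic f 1)
    (hf : ∀ a b, IntervalIntegrable f volume a b) {B : ℕ} (hB : 0 < B) :
    ∫ y in (0 : ℝ)..1, f (B * y) = ∫ y in (0 : ℝ)..1, f y := by
  have hB' : (B : ℝ) ≠ 0 := by positivity
  have h := hp.intervalIntegral_add_zsmul_eq B 0 hf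
  simp only [zsmul_eq_mul, mul_one, zero_add, Int.cast_natCast] at h
  rw [intervalIntegral.integral_comp_mul_left _ hB', mul_zero, mul_one, h, smul_eq_mul,
    inv_mul_cancel_left₀ hB']

theorem periodic_comp_natCast_mul {f : ℝ → ℝ} (hp : Function.Periodic f 1) (B : ℕ) :
    Function.Periodic (fun y => f (B * y)) 1 := fun y => by
  simpa [mul_add] using hp.nat_mul B (B * y)

/-- The constant part of the first factor meets a mean-zero function. What remains is the integral
of `centeredInd t (B * y)` over [0, t], and rescaling turns it into B⁻¹ times a bounded primitive.
-/
theorem integral_centeredInd_mul_le {t : ℝ} (h0 : 0 ≤ t) (h1 : t ≤ 1) {B : ℕ} (hB : 0 < B) :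
    ∫ y in (0 : ℝ)..1, centeredInd t y * centeredInd t (B * y) ≤ (B : ℝ)⁻¹ := by
  have hB' : (B : ℝ) ≠ 0 := by positivity
  have hm : Measurable fun y : ℝ => centeredInd t (B * y) :=
    (measurable_centeredInd t).comp (measurable_const_mul _)
  have hi : IntervalIntegrable
      (fun y => if Int.fract y < t then centeredInd t (B * y) else 0) volume 0 1 := by
    refine intervalIntegrable_of_abs_le (C := 1) (Measurable.ite
      (measurableSet_lt measurable_fract measurable_const) hm measurable_const) ?_ _ _
    intro x
    split_ifs
    · exact abs_centeredInd_le h0 h1 _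
    · simp
  have hi2 : IntervalIntegrable (fun y => t * centeredInd t (B * y)) volume 0 1 :=
    (intervalIntegrable_of_abs_le hm (fun x => abs_centeredInd_le h0 h1 _) _ _).const_mul _
  have : ∀ y, centeredInd t y * centeredInd t (B * y) =
      (if Int.fract y < t then centeredInd t (B * y) else 0) - t * centeredInd t (B * y) := by
    intro y
    rw [centeredInd]
    split_ifs <;> ring
  simp_rw [this]
  rw [intervalIntegral.integral_sub hi hi2, integral_fract_lt_mul h0 h1,
    intervalIntegral.integral_const_mul, integral_comp_natCast_mul_of_periodic
      (periodic_centeredInd t) (intervalIntegrable_centeredInd h0 h1) hB,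
    integral_centeredInd h0 h1, mul_zero, sub_zero, intervalIntegral.integral_comp_mul_left _ hB',
    mul_zero, smul_eq_mul]
  have := (abs_le.1 (abs_integral_centeredInd_le h0 h1 (B * t))).2
  exact mul_le_of_le_one_right (by positivity) this

/-- The partial products `q₁ ⋯ qₙ`. -/
def partialProd (Q : ℕ → ℕ) (n : ℕ) : ℕ := ∏ k ∈ Finset.range n, Q k

theorem T_eq_fract (Q : ℕ → ℕ) (n : ℕ) (x : ℝ) : T Q n x = Int.fract (partialProd Q n * x) := by
  simp [T, partialProd]

theorem partialProd_pos {Q : ℕ → ℕ} (hQ : ∀ k, 0 < Q k) (n : ℕ) : 0 < partialProd Q n :=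
  Finset.prod_pos fun k _ => hQ k

theorem partialProd_succ (Q : ℕ → ℕ) (n : ℕ) :
    partialProd Q (n + 1) = partialProd Q n * Q n := Finset.prod_range_succ _ _

theorem integral_centeredInd_partialProd_mul_le {t : ℝ} (h0 : 0 ≤ t) (h1 : t ≤ 1) {Q : ℕ → ℕ}
    (hQ : IsBasicSequence Q) {i j : ℕ} (hij : i ≤ j) :
    ∫ y in (0 : ℝ)..1, centeredInd t (partialProd Q i * y) * centeredInd t (partialProd Q j * y) ≤
      (1 / 2) ^ (j - i) := by
  have hpos : ∀ k, 0 < Q k := fun k => zero_lt_two.trans_le (hQ k)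
  set B := ∏ k ∈ Finset.Ico i j, Q k
  have hB : 0 < B := Finset.prod_pos fun k _ => hpos k
  have hP : partialProd Q j = B * partialProd Q i := by
    rw [mul_comm]; exact (Finset.prod_range_mul_prod_Ico _ hij).symm
  have hB2 : 2 ^ (j - i) ≤ B := by
    have := Finset.pow_card_le_prod (Finset.Ico i j) Q 2 (fun k _ => hQ k)
    simpa using this
  have hm : Measurable fun y : ℝ => centeredInd t y * centeredInd t (B * y) :=
    (measurable_centeredInd t).mul ((measurable_centeredInd t).comp (measurable_const_mul _))
  have hb : ∀ y : ℝ, |centeredInd t y * centeredInd t (B * y)| ≤ 1 := fun y => by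
    rw [abs_mul]
    exact mul_le_one₀ (abs_centeredInd_le h0 h1 _) (abs_nonneg _) (abs_centeredInd_le h0 h1 _)
  have := integral_comp_natCast_mul_of_periodic
    (f := fun y => centeredInd t y * centeredInd t (B * y))
    ((periodic_centeredInd t).mul (periodic_comp_natCast_mul (periodic_centeredInd t) B))
    (intervalIntegrable_of_abs_le hm hb) (partialProd_pos hpos i)
  have e : ∀ y : ℝ, (partialProd Q j : ℝ) * y = B * (partialProd Q i * y) := fun y => by
    rw [hP]; push_cast; ring
  simp_rw [e]
  rw [this]
  refine (integral_centeredInd_mul_le h0 h1 hB).trans ?_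
  rw [one_div, inv_pow]
  refine inv_anti₀ (by positivity) ?_
  exact_mod_cast hB2

/-! ### Second moments and almost everywhere equidistribution. -/

/-- The discrepancy sum `#{i < n : T_{Q,i}(x) < t} - n t`. -/
noncomputable def discSum (Q : ℕ → ℕ) (t : ℝ) (n : ℕ) (x : ℝ) : ℝ :=
  ∑ i ∈ Finset.range n, centeredInd t (partialProd Q i * x)

theorem measurable_discSum (Q : ℕ → ℕ) (t : ℝ) (n : ℕ) : Measurable (discSum Q t n) :=
  Finset.measurable_fun_sum _ fun _ _ => (measurable_centeredInd t).comp (measurable_const_mul _)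

theorem abs_discSum_le (Q : ℕ → ℕ) {t : ℝ} (h0 : 0 ≤ t) (h1 : t ≤ 1) (n : ℕ) (x : ℝ) :
    |discSum Q t n x| ≤ n := by
  refine (Finset.abs_sum_le_sum_abs _ _).trans ?_
  refine (Finset.sum_le_sum fun i _ => abs_centeredInd_le h0 h1 _).trans ?_
  simp

theorem periodic_discSum (Q : ℕ → ℕ) (t : ℝ) (n : ℕ) : Function.Periodic (discSum Q t n) 1 :=
  fun x => Finset.sum_congr rfl fun i _ =>
    periodic_comp_natCast_mul (periodic_centeredInd t) (partialProd Q i) x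

/-- Each new term adds at most 3: twice a sum of correlations dominated by a geometric series of sum
at most 1, plus a diagonal term at most 1. -/
theorem integral_discSum_sq_le {Q : ℕ → ℕ} (hQ : IsBasicSequence Q) {t : ℝ} (h0 : 0 ≤ t)
    (h1 : t ≤ 1) (n : ℕ) : ∫ x in (0 : ℝ)..1, discSum Q t n x ^ 2 ≤ 3 * n := by
  induction n with
  | zero => simp [discSum]
  | succ n ih =>
    set f : ℕ → ℝ → ℝ := fun i x => centeredInd t (partialProd Q i * x) with hf
    have hfm : ∀ i, Measurable (f i) := fun i =>
      (measurable_centeredInd t).comp (measurable_const_mul _)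
    have hfb : ∀ i x, |f i x| ≤ 1 := fun i x => abs_centeredInd_le h0 h1 _
    have hfi : ∀ i, IntervalIntegrable (fun x => f i x * f n x) volume 0 1 := fun i =>
      intervalIntegrable_of_abs_le (C := 1) ((hfm i).mul (hfm n)) (fun x => by
        rw [Pi.mul_apply, abs_mul]; exact mul_le_one₀ (hfb i x) (abs_nonneg _) (hfb n x)) _ _
    have hS : IntervalIntegrable (fun x => discSum Q t n x ^ 2) volume 0 1 :=
      intervalIntegrable_of_abs_le (C := n ^ 2) ((measurable_discSum Q t n).pow_const 2) (fun x => by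
        rw [abs_pow]; exact pow_le_pow_left₀ (abs_nonneg _) (abs_discSum_le Q h0 h1 n x) 2) _ _
    have e : ∀ x, discSum Q t (n + 1) x ^ 2 =
        discSum Q t n x ^ 2 + (2 * ∑ i ∈ Finset.range n, f i x * f n x + f n x * f n x) := by
      intro x
      have : discSum Q t (n + 1) x = discSum Q t n x + f n x := Finset.sum_range_succ _ _
      rw [this, ← Finset.sum_mul]
      change _ = discSum Q t n x ^ 2 + (2 * (discSum Q t n x * f n x) + _)
      ring
    have hsum : IntervalIntegrable (fun x => ∑ i ∈ Finset.range n, f i x * f n x) volume 0 1 := by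
      simpa only [Finset.sum_fn] using IntervalIntegrable.sum (Finset.range n) fun i _ => hfi i
    simp_rw [e]
    rw [intervalIntegral.integral_add hS ((hsum.const_mul 2).add (hfi n)),
      intervalIntegral.integral_add (hsum.const_mul 2) (hfi n),
      intervalIntegral.integral_const_mul,
      intervalIntegral.integral_finsetSum fun i _ => hfi i]
    have h2 : ∑ i ∈ Finset.range n, ∫ x in (0 : ℝ)..1, f i x * f n x ≤ 1 := by
      calc ∑ i ∈ Finset.range n, ∫ x in (0 : ℝ)..1, f i x * f n x
          ≤ ∑ i ∈ Finset.range n, (1 / 2 : ℝ) ^ (n - i) := Finset.sum_le_sum fun i hi =>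
            integral_centeredInd_partialProd_mul_le h0 h1 hQ (Finset.mem_range.1 hi).le
        _ = ∑ i ∈ Finset.range n, (1 / 2 : ℝ) ^ (i + 1) := by
            rw [← Finset.sum_range_reflect]
            refine Finset.sum_congr rfl fun i hi => ?_
            have := Finset.mem_range.1 hi
            congr 1; omega
        _ = 1 - (1 / 2) ^ n := by
            simp_rw [pow_succ, ← Finset.sum_mul]
            rw [geom_sum_eq (by norm_num)]; ring
        _ ≤ 1 := by simp
    have h3 : ∫ x in (0 : ℝ)..1, f n x * f n x ≤ 1 := by
      simpa using integral_centeredInd_partialProd_mul_le h0 h1 hQ (le_refl n)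
    push_cast
    linarith

theorem ae_tendsto_discSum_sq {Q : ℕ → ℕ} (hQ : IsBasicSequence Q) {t : ℝ} (h0 : 0 ≤ t)
    (h1 : t ≤ 1) : ∀ᵐ x : ℝ, Tendsto (fun m : ℕ => discSum Q t ((m + 1) ^ 2) x / ((m + 1 : ℕ) ^ 2 : ℕ))
      atTop (𝓝 0) := by
  -- By periodicity it suffices to work on unit intervals, countably many of which cover the line.
  rw [← Measure.restrict_univ (μ := volume), ← iUnion_Ioc_intCast, ae_restrict_iUnion_iff]
  intro a
  set g : ℕ → ℝ → ℝ := fun m x => (discSum Q t ((m + 1) ^ 2) x / ((m + 1 : ℕ) ^ 2 : ℕ)) ^ 2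
  have hgm : ∀ m, Measurable (g m) := fun m =>
    ((measurable_discSum Q t _).div_const _).pow_const 2
  have hg0 : ∀ m x, 0 ≤ g m x := fun m x => sq_nonneg _
  have hg1 : ∀ m x, |g m x| ≤ 1 := fun m x => by
    rw [abs_pow, sq_le_one_iff₀ (abs_nonneg _), abs_div, Nat.abs_cast]
    exact div_le_one_of_le₀ (abs_discSum_le Q h0 h1 _ x) (by positivity)
  have hgp : ∀ m, Function.Periodic (g m) 1 := fun m x => by
    simp only [g]; rw [periodic_discSum Q t]
  have hint : ∀ m, ∫ x in Set.Ioc (a : ℝ) (a + 1), g m x ≤ 3 / ((m : ℝ) + 1) ^ 2 := by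
    intro m
    rw [← intervalIntegral.integral_of_le (by simp), (hgp m).intervalIntegral_add_eq _ 0, zero_add]
    simp only [g, div_pow]
    rw [intervalIntegral.integral_div, div_le_div_iff₀ (by positivity) (by positivity)]
    have := integral_discSum_sq_le hQ h0 h1 ((m + 1) ^ 2)
    push_cast at this ⊢
    calc _ ≤ (3 * ((m : ℝ) + 1) ^ 2) * ((m : ℝ) + 1) ^ 2 := by gcongr
      _ = _ := by ring
  have hl : ∀ m, ∫⁻ x in Set.Ioc (a : ℝ) (a + 1), ENNReal.ofReal (g m x) ≤
      ENNReal.ofReal (3 / ((m : ℝ) + 1) ^ 2) := fun m => by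
    rw [← ofReal_integral_eq_lintegral_ofReal _ (Eventually.of_forall (hg0 m))]
    · exact ENNReal.ofReal_le_ofReal (hint m)
    · exact Measure.integrableOn_of_bounded (M := 1) (by simp) (hgm m).aestronglyMeasurable
        (Eventually.of_forall (hg1 m))
  have hs : Summable fun m : ℕ => 3 / ((m : ℝ) + 1) ^ 2 := by
    have := (summable_nat_add_iff 1).2 (Real.summable_one_div_nat_pow.2 one_lt_two)
    simpa [div_eq_mul_inv] using this.mul_left 3
  have hfin : ∫⁻ x in Set.Ioc (a : ℝ) (a + 1), ∑' m, ENNReal.ofReal (g m x) ≠ ⊤ := by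
    rw [lintegral_tsum fun m => (hgm m).ennreal_ofReal.aemeasurable]
    exact ne_top_of_le_ne_top hs.tsum_ofReal_ne_top (ENNReal.tsum_le_tsum hl)
  have hae := ae_lt_top' (AEMeasurable.tsum fun m => (hgm m).ennreal_ofReal.aemeasurable) hfin
  filter_upwards [hae] with x hx
  have h := ENNReal.tendsto_atTop_zero_of_tsum_ne_top hx.ne
  have h2 : Tendsto (fun m => g m x) atTop (𝓝 0) := by
    have := (ENNReal.tendsto_toReal ENNReal.zero_ne_top).comp h
    simpa [Function.comp_def, ENNReal.toReal_ofReal (hg0 _ x)] using this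
  have h3 := h2.sqrt
  simp only [g, Real.sqrt_sq_eq_abs, Real.sqrt_zero] at h3
  exact (tendsto_zero_iff_abs_tendsto_zero _).2 h3

theorem discSum_eq (Q : ℕ → ℕ) (t : ℝ) (n : ℕ) (x : ℝ) :
    discSum Q t n x = countIn (Set.Ico 0 t) (fun i => T Q i x) n - n * t := by
  classical
  simp only [discSum, centeredInd, countIn, Finset.card_filter, Finset.sum_sub_distrib,
    T_eq_fract, Set.mem_Ico, Int.fract_nonneg, true_and, Finset.sum_const, Finset.card_range,
    nsmul_eq_mul, Nat.cast_sum, Nat.cast_ite, Nat.cast_one, Nat.cast_zero]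

theorem monotone_countIn (I : Set ℝ) (ω : ℕ → ℝ) : Monotone (countIn I ω) := fun m n h => by
  classical
  exact Finset.card_le_card (Finset.filter_subset_filter _ (Finset.range_mono h))

theorem countIn_le (I : Set ℝ) (ω : ℕ → ℝ) (n : ℕ) : countIn I ω n ≤ n := by
  classical
  exact (Finset.card_filter_le _ _).trans (Finset.card_range n).le

theorem countIn_mono {I J : Set ℝ} (h : I ⊆ J) (ω : ℕ → ℝ) (n : ℕ) :
    countIn I ω n ≤ countIn J ω n := by
  classical
  exact Finset.card_le_card (Finset.monotone_filter_right _ fun i _ hi => h hi)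

theorem ae_tendsto_countIn {Q : ℕ → ℕ} (hQ : IsBasicSequence Q) {t : ℝ} (h0 : 0 ≤ t)
    (h1 : t ≤ 1) : ∀ᵐ x : ℝ, Tendsto
      (fun n : ℕ => (countIn (Set.Ico 0 t) (fun i => T Q i x) n : ℝ) / n) atTop (𝓝 t) := by
  filter_upwards [ae_tendsto_discSum_sq hQ h0 h1] with x hx
  refine tendsto_div_of_monotone_of_exists_subseq_tendsto_div
    (fun n => (countIn (Set.Ico 0 t) (fun i => T Q i x) n : ℝ)) t
    (fun m n h => Nat.cast_le.2 (monotone_countIn _ _ h)) fun a ha => ?_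
  refine ⟨fun m => (m + 1) ^ 2, ?_, ?_, ?_⟩
  -- Consecutive squares have ratio tending to 1, so monotone counts are controlled between them.
  · have h : Tendsto (fun m : ℕ => (1 + 1 / ((m : ℝ) + 1)) ^ 2) atTop (𝓝 ((1 + 0) ^ 2)) :=
      (tendsto_one_div_add_atTop_nhds_zero_nat.const_add 1).pow 2
    have := h.eventually (gt_mem_nhds (show (1 + 0 : ℝ) ^ 2 < a by simpa using ha))
    filter_upwards [this] with m hm
    have hm0 : (0 : ℝ) < (m : ℝ) + 1 := by positivity
    have e : (((m + 1 + 1) ^ 2 : ℕ) : ℝ) = (1 + 1 / ((m : ℝ) + 1)) ^ 2 * ((m : ℝ) + 1) ^ 2 := by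
      push_cast; field_simp
    rw [e]
    push_cast
    gcongr
  · exact (tendsto_pow_atTop two_ne_zero).comp (tendsto_add_atTop_nat 1)
  · have := hx.add_const t
    rw [zero_add] at this
    refine this.congr fun m => ?_
    rw [discSum_eq]
    have : (((m + 1) ^ 2 : ℕ) : ℝ) ≠ 0 := by positivity
    field_simp
    ring

/-- Countably many t suffice: counts are monotone in t and the limit t ↦ t is continuous, so
rationals on either side squeeze. -/
theorem hasADF_id_of_tendsto_rat {ω : ℕ → ℝ} (h : ∀ t : ℚ, 0 ≤ (t : ℝ) → (t : ℝ) ≤ 1 →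
    Tendsto (fun n : ℕ => (countIn (Set.Ico 0 (t : ℝ)) ω n : ℝ) / n) atTop (𝓝 t)) :
    HasADF ω id := by
  refine ⟨⟨monotone_id, rfl, rfl⟩, fun t => ?_⟩
  have ht0 := t.2.1
  have ht1 := t.2.2
  rw [id, tendsto_order]
  refine ⟨fun a ha => ?_, fun a ha => ?_⟩
  · rcases lt_or_ge a 0 with ha0 | ha0
    · exact Eventually.of_forall fun n => ha0.trans_le (by positivity)
    obtain ⟨r, har, hrt⟩ := exists_rat_btwn ha
    filter_upwards [(h r (ha0.trans har.le) (hrt.le.trans ht1)).eventually (lt_mem_nhds har)]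
      with n hn
    refine hn.trans_le ?_
    have := countIn_mono (Set.Ico_subset_Ico_right hrt.le : Set.Ico (0 : ℝ) r ⊆ _) ω n
    gcongr
  · rcases lt_or_ge 1 a with ha1 | ha1
    · exact Eventually.of_forall fun n => lt_of_le_of_lt
        (div_le_one_of_le₀ (Nat.cast_le.2 (countIn_le _ _ _)) (by positivity)) ha1
    obtain ⟨r, htr, hra⟩ := exists_rat_btwn ha
    filter_upwards [(h r (ht0.trans htr.le) (hra.le.trans ha1)).eventually (gt_mem_nhds hra)]
      with n hn
    refine lt_of_le_of_lt ?_ hn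
    have := countIn_mono (Set.Ico_subset_Ico_right htr.le : _ ⊆ Set.Ico (0 : ℝ) r) ω n
    gcongr

theorem volume_noADFSet {Q : ℕ → ℕ} (hQ : IsBasicSequence Q) : volume (noADFSet Q) = 0 := by
  have h : ∀ᵐ x : ℝ, ∀ t : ℚ, 0 ≤ (t : ℝ) → (t : ℝ) ≤ 1 → Tendsto
      (fun n : ℕ => (countIn (Set.Ico 0 (t : ℝ)) (fun i => T Q i x) n : ℝ) / n) atTop (𝓝 t) := by
    simp only [ae_all_iff]
    exact fun t h0 h1 => ae_tendsto_countIn hQ h0 h1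
  have h' : ∀ᵐ x : ℝ, ∃ f : unitInterval → unitInterval, HasADF (fun n => T Q n x) f := by
    filter_upwards [h] with x hx
    exact ⟨id, hasADF_id_of_tendsto_rat hx⟩
  exact ae_iff.1 h'

/-! ### Cantor series and their tails. -/

theorem two_pow_le_partialProd {Q : ℕ → ℕ} (hQ : IsBasicSequence Q) (n : ℕ) :
    2 ^ n ≤ partialProd Q n := by
  simpa [partialProd] using Finset.pow_card_le_prod (Finset.range n) Q 2 fun k _ => hQ k

/-- The value `∑ e_j / (q₀ ⋯ q_j)` of the Cantor series with digits `e`. -/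
noncomputable def seriesValue (Q e : ℕ → ℕ) : ℝ := ∑' j, (e j : ℝ) / partialProd Q (j + 1)

/-- This is the telescoping inequality behind both the convergence of the series and the bound 1 on
its value. -/
theorem digit_div_le {Q e : ℕ → ℕ} (hQ : IsBasicSequence Q) (he : ∀ k, e k < Q k) (j : ℕ) :
    (e j : ℝ) / partialProd Q (j + 1) + 1 / partialProd Q (j + 1) ≤ 1 / partialProd Q j := by
  have hP : (0 : ℝ) < partialProd Q j :=
    Nat.cast_pos.2 (partialProd_pos (fun k => zero_lt_two.trans_le (hQ k)) j)
  have hq : (0 : ℝ) < Q j := Nat.cast_pos.2 (zero_lt_two.trans_le (hQ j))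
  have hej : (e j : ℝ) + 1 ≤ Q j := by exact_mod_cast he j
  rw [← add_div, partialProd_succ, Nat.cast_mul, div_le_div_iff₀ (by positivity) hP]
  nlinarith

theorem summable_seriesValue {Q e : ℕ → ℕ} (hQ : IsBasicSequence Q) (he : ∀ k, e k < Q k) :
    Summable fun j => (e j : ℝ) / partialProd Q (j + 1) := by
  refine Summable.of_nonneg_of_le (fun j => by positivity) (fun j => ?_)
    (summable_geometric_of_lt_one (r := 1 / 2) (by norm_num) (by norm_num))
  have h1 := digit_div_le hQ he j
  have h2 : (0 : ℝ) ≤ 1 / partialProd Q (j + 1) := by positivity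
  have h3 : (1 : ℝ) / partialProd Q j ≤ (1 / 2) ^ j := by
    rw [one_div_pow]
    exact one_div_le_one_div_of_le (by positivity) (by exact_mod_cast two_pow_le_partialProd hQ j)
  linarith

theorem seriesValue_nonneg (Q e : ℕ → ℕ) : 0 ≤ seriesValue Q e :=
  tsum_nonneg fun j => by positivity

theorem seriesValue_le_one {Q e : ℕ → ℕ} (hQ : IsBasicSequence Q) (he : ∀ k, e k < Q k) :
    seriesValue Q e ≤ 1 := by
  refine Real.tsum_le_of_sum_range_le (fun j => by positivity) fun n => ?_
  have : ∑ j ∈ Finset.range n, (e j : ℝ) / partialProd Q (j + 1) + 1 / partialProd Q n ≤ 1 := by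
    induction n with
    | zero => simp [partialProd]
    | succ n ih =>
      rw [Finset.sum_range_succ]
      linarith [digit_div_le hQ he n]
  have h2 : (0 : ℝ) ≤ 1 / partialProd Q n := by positivity
  linarith

/-- The value of the Cantor series with the first `n` digits and bases removed. -/
noncomputable def tailValue (Q e : ℕ → ℕ) (n : ℕ) : ℝ :=
  seriesValue (fun k => Q (n + k)) fun k => e (n + k)

theorem tailValue_zero (Q e : ℕ → ℕ) : tailValue Q e 0 = seriesValue Q e := by
  simp [tailValue]

theorem tailValue_nonneg (Q e : ℕ → ℕ) (n : ℕ) : 0 ≤ tailValue Q e n :=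
  seriesValue_nonneg _ _

theorem tailValue_le_one {Q e : ℕ → ℕ} (hQ : IsBasicSequence Q) (he : ∀ k, e k < Q k) (n : ℕ) :
    tailValue Q e n ≤ 1 :=
  seriesValue_le_one (fun _ => hQ _) fun _ => he _

theorem mul_tailValue {Q e : ℕ → ℕ} (hQ : IsBasicSequence Q) (he : ∀ k, e k < Q k) (n : ℕ) :
    Q n * tailValue Q e n = e n + tailValue Q e (n + 1) := by
  have hq : (Q n : ℝ) ≠ 0 := Nat.cast_ne_zero.2 (zero_lt_two.trans_le (hQ n)).ne'
  have hs := summable_seriesValue (Q := fun k => Q (n + k)) (e := fun k => e (n + k))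
    (fun _ => hQ _) fun _ => he _
  unfold tailValue seriesValue
  rw [hs.tsum_eq_zero_add, mul_add, ← tsum_mul_left]
  congr 1
  · simp only [partialProd, zero_add, Finset.prod_range_one, add_zero]
    field_simp
  · refine tsum_congr fun j => ?_
    have : partialProd (fun k => Q (n + k)) (j + 1 + 1) =
        Q n * partialProd (fun k => Q (n + 1 + k)) (j + 1) := by
      rw [partialProd, Finset.prod_range_succ', mul_comm]
      simp [partialProd, add_assoc, add_comm 1]
    rw [this, show n + (j + 1) = n + 1 + j by ring, Nat.cast_mul, ← mul_div_assoc,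
      mul_div_mul_left _ _ hq]

/-- The hypothesis excludes a tail equal to 1, where all later digits are maximal and the fractional
part would be 0. -/
theorem T_seriesValue {Q e : ℕ → ℕ} (hQ : IsBasicSequence Q) (he : ∀ k, e k < Q k) {n : ℕ}
    (hn : tailValue Q e n < 1) : T Q n (seriesValue Q e) = tailValue Q e n := by
  have : ∀ n, ∃ z : ℤ, partialProd Q n * seriesValue Q e = z + tailValue Q e n := by
    intro n
    induction n with
    | zero => exact ⟨0, by simp [partialProd, tailValue_zero]⟩
    | succ n ih =>
      obtain ⟨z, hz⟩ := ih
      refine ⟨Q n * z + e n, ?_⟩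
      rw [partialProd_succ]
      push_cast
      linear_combination (Q n : ℝ) * hz + mul_tailValue hQ he n
  obtain ⟨z, hz⟩ := this n
  rw [T_eq_fract, hz, Int.fract_intCast_add, Int.fract_eq_self.2 ⟨tailValue_nonneg Q e n, hn⟩]

/-! ### Digit transfer and its Hölder inverse. -/

/-- The digit of index `k` in the Cantor series expansion of `u`. -/
noncomputable def digit (Q : ℕ → ℕ) (u : ℝ) (k : ℕ) : ℕ := ⌊Q k * T Q k u⌋₊

theorem T_nonneg (Q : ℕ → ℕ) (n : ℕ) (x : ℝ) : 0 ≤ T Q n x := Int.fract_nonneg _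

theorem T_lt_one (Q : ℕ → ℕ) (n : ℕ) (x : ℝ) : T Q n x < 1 := Int.fract_lt_one _

theorem T_zero (Q : ℕ → ℕ) {u : ℝ} (hu : u ∈ Set.Ico (0 : ℝ) 1) : T Q 0 u = u := by
  simpa [T] using hu

theorem digit_lt {Q : ℕ → ℕ} {k : ℕ} (hQ : 0 < Q k) (u : ℝ) : digit Q u k < Q k := by
  rw [digit, Nat.floor_lt (mul_nonneg (Nat.cast_nonneg _) (T_nonneg _ _ _))]
  exact mul_lt_of_lt_one_right (Nat.cast_pos.2 hQ) (T_lt_one _ _ _)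

theorem mul_T (Q : ℕ → ℕ) (u : ℝ) (n : ℕ) : Q n * T Q n u = digit Q u n + T Q (n + 1) u := by
  have h0 : 0 ≤ Q n * T Q n u := mul_nonneg (Nat.cast_nonneg _) (T_nonneg _ _ _)
  have h : T Q (n + 1) u = Int.fract (Q n * T Q n u) := by
    rw [T_eq_fract, T_eq_fract, Int.fract_eq_fract, partialProd_succ]
    refine ⟨Q n * ⌊partialProd Q n * u⌋, ?_⟩
    rw [Int.fract]
    push_cast
    ring
  rw [h, digit, natCast_floor_eq_intCast_floor h0, Int.floor_add_fract]

/-- Only the digit recursion is used, so this serves both the orbit `T m` and the tails in base `Q`.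
-/
theorem partialProd_mul_sub {Q e e' : ℕ → ℕ} {s s' : ℕ → ℝ}
    (hs : ∀ n, Q n * s n = e n + s (n + 1)) (hs' : ∀ n, Q n * s' n = e' n + s' (n + 1)) {k : ℕ}
    (h : ∀ i < k, e i = e' i) : partialProd Q k * (s 0 - s' 0) = s k - s' k := by
  induction k with
  | zero => simp [partialProd]
  | succ k ih =>
    have h1 := ih fun i hi => h i (hi.trans k.lt_succ_self)
    have h2 : (e k : ℝ) = e' k := by rw [h k k.lt_succ_self]
    rw [partialProd_succ]
    push_cast
    linear_combination (Q k : ℝ) * h1 + hs k - hs' k + h2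

/-- Reads the base-`m` digits of `u`, shifted by `off`, as digits in base `Q`. -/
noncomputable def transfer (Q m off : ℕ → ℕ) (u : ℝ) : ℝ :=
  seriesValue Q fun k => digit m u k + off k

/-- Allowed digits fill at most half of the range. This gap keeps later digits from cancelling a
difference at an earlier one. -/
theorem tailValue_sub_le {Q m d d' off : ℕ → ℕ} (hQ : IsBasicSequence Q)
    (hmQ : ∀ k, 2 * m k ≤ Q k) (hoff : ∀ k, off k + m k ≤ Q k) (hd : ∀ k, d k < m k)
    (hd' : ∀ k, d' k < m k) (n : ℕ) :
    tailValue Q (fun k => d k + off k) n - tailValue Q (fun k => d' k + off k) n ≤ 1 / 2 := by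
  have he : ∀ k, d k + off k < Q k := fun k => by linarith [hd k, hoff k]
  have he' : ∀ k, d' k + off k < Q k := fun k => by linarith [hd' k, hoff k]
  have h1 := mul_tailValue hQ he n
  have h2 := mul_tailValue hQ he' n
  have h3 := tailValue_le_one hQ he (n + 1)
  have h4 := tailValue_nonneg Q (fun k => d' k + off k) (n + 1)
  have h5 : (2 : ℝ) * m n ≤ Q n := by exact_mod_cast hmQ n
  have h6 : (d n : ℝ) + 1 ≤ m n := by exact_mod_cast hd n
  have h7 : (0 : ℝ) ≤ d' n := by positivity
  have hq : (0 : ℝ) < Q n := Nat.cast_pos.2 (zero_lt_two.trans_le (hQ n))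
  push_cast at h1 h2
  refine le_of_mul_le_mul_left ?_ hq
  linarith

/-- Let k be the first index where the digits differ, D their difference and s = |D|/m_k ≤ 1. Scaled
by the base-m product, |u - v| is at most 2s; scaled by the base-Q product, the image distance is at
least s/16. Then s ≤ s^r and `hC` compare the two scales. -/
theorem abs_sub_le_transfer {Q m off : ℕ → ℕ} (hQ : IsBasicSequence Q) (hm : ∀ k, 0 < m k)
    (hmQ : ∀ k, 2 * m k ≤ Q k) (hQm : ∀ k, Q k ≤ 8 * m k) (hoff : ∀ k, off k + m k ≤ Q k)
    {r C : ℝ} (hr0 : 0 < r) (hr1 : r < 1) (hC : ∀ k, (partialProd Q k : ℝ) ^ r ≤ C * partialProd m k)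
    {u v : ℝ} (hu : u ∈ Set.Ico (0 : ℝ) 1) (hv : v ∈ Set.Ico (0 : ℝ) 1) :
    |u - v| ≤ 2 * C * 16 ^ r * |transfer Q m off u - transfer Q m off v| ^ r := by
  have hMpos : ∀ k, (0 : ℝ) < partialProd m k := fun k => Nat.cast_pos.2 (partialProd_pos hm k)
  have hPpos : ∀ k, (0 : ℝ) < partialProd Q k := fun k =>
    Nat.cast_pos.2 (partialProd_pos (fun k => zero_lt_two.trans_le (hQ k)) k)
  have hC0 : 0 < C := by
    have := hC 0
    simp only [partialProd, Finset.range_zero, Finset.prod_empty, Nat.cast_one, Real.one_rpow,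
      mul_one] at this
    linarith
  have hagree : ∀ k, (∀ i < k, digit m u i = digit m v i) →
      partialProd m k * (u - v) = T m k u - T m k v := fun k h => by
    have := partialProd_mul_sub (mul_T m u) (mul_T m v) h
    rwa [T_zero m hu, T_zero m hv] at this
  by_cases hex : ∃ k, digit m u k ≠ digit m v k
  · classical
    set k := Nat.find hex
    have hk : digit m u k ≠ digit m v k := Nat.find_spec hex
    have hlt : ∀ i < k, digit m u i = digit m v i := fun i hi => not_not.1 (Nat.find_min hex hi)
    have hdu : ∀ i, digit m u i < m i := fun i => digit_lt (hm i) u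
    have hdv : ∀ i, digit m v i < m i := fun i => digit_lt (hm i) v
    have heu : ∀ i, digit m u i + off i < Q i := fun i => by linarith [hdu i, hoff i]
    have hev : ∀ i, digit m v i + off i < Q i := fun i => by linarith [hdv i, hoff i]
    have hX := partialProd_mul_sub (mul_tailValue hQ heu) (mul_tailValue hQ hev)
      (k := k) fun i hi => by rw [hlt i hi]
    rw [tailValue_zero, tailValue_zero] at hX
    change _ * (transfer Q m off u - transfer Q m off v) = _ at hX
    have hU := hagree k hlt
    have hXu := mul_tailValue hQ heu k
    have hXv := mul_tailValue hQ hev k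
    have hUu := mul_T m u k
    have hUv := mul_T m v k
    have hs1 := tailValue_sub_le hQ hmQ hoff hdu hdv (k + 1)
    have hs2 := tailValue_sub_le hQ hmQ hoff hdv hdu (k + 1)
    push_cast at hXu hXv
    set D : ℝ := (digit m u k : ℝ) - digit m v k with hD
    have hD1 : 1 ≤ |D| := by
      have h : (1 : ℤ) ≤ |(digit m u k : ℤ) - digit m v k| :=
        Int.one_le_abs (sub_ne_zero.2 (by exact_mod_cast hk))
      have h' : ((1 : ℤ) : ℝ) ≤ ((|(digit m u k : ℤ) - digit m v k| : ℤ) : ℝ) := by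
        exact_mod_cast h
      simpa [hD] using h'
    have hDm : |D| ≤ m k := by
      have h1 : (digit m u k : ℝ) < m k := by exact_mod_cast hdu k
      have h2 : (digit m v k : ℝ) < m k := by exact_mod_cast hdv k
      have h3 : (0 : ℝ) ≤ digit m u k := by positivity
      have h4 : (0 : ℝ) ≤ digit m v k := by positivity
      rw [abs_le]; constructor <;> linarith
    have hmk : (0 : ℝ) < m k := by exact_mod_cast hm k
    have hQk : (0 : ℝ) < Q k := by exact_mod_cast zero_lt_two.trans_le (hQ k)
    have hQmk : (Q k : ℝ) ≤ 8 * m k := by exact_mod_cast hQm k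
    set x := transfer Q m off u - transfer Q m off v
    -- upper bound for `|u - v|`
    have hup : partialProd m k * |u - v| ≤ 2 * (|D| / m k) := by
      have e : m k * (partialProd m k * (u - v)) = D + (T m (k + 1) u - T m (k + 1) v) := by
        rw [hU, hD]; linear_combination hUu - hUv
      have h1 : |T m (k + 1) u - T m (k + 1) v| ≤ 1 := by
        rw [abs_le]; constructor <;>
          linarith [T_nonneg m (k + 1) u, T_lt_one m (k + 1) u, T_nonneg m (k + 1) v,
            T_lt_one m (k + 1) v]
      have h2 : m k * (partialProd m k * |u - v|) ≤ 2 * |D| := by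
        calc _ = |(m k : ℝ) * (partialProd m k * (u - v))| := by
              rw [abs_mul, abs_mul, Nat.abs_cast, Nat.abs_cast]
          _ ≤ |D| + |T m (k + 1) u - T m (k + 1) v| := by rw [e]; exact abs_add_le _ _
          _ ≤ _ := by linarith
      rw [← mul_div_assoc, le_div_iff₀ hmk, mul_comm]
      exact h2
    -- lower bound for `|x|`
    have hlow : |D| / m k ≤ 16 * (partialProd Q k * |x|) := by
      have e : Q k * (partialProd Q k * x) = D + (tailValue Q (fun i => digit m u i + off i) (k + 1)
          - tailValue Q (fun i => digit m v i + off i) (k + 1)) := by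
        rw [hX, hD]; linear_combination hXu - hXv
      have h1 : |tailValue Q (fun i => digit m u i + off i) (k + 1)
          - tailValue Q (fun i => digit m v i + off i) (k + 1)| ≤ 1 / 2 := by
        rw [abs_le]; constructor <;> linarith
      have h2 : |D| ≤ 2 * (Q k * (partialProd Q k * |x|)) := by
        have h3 : Q k * (partialProd Q k * |x|) = |(Q k : ℝ) * (partialProd Q k * x)| := by
          rw [abs_mul, abs_mul, Nat.abs_cast, Nat.abs_cast]
        rw [h3, e]
        have := abs_sub_abs_le_abs_add D (tailValue Q (fun i => digit m u i + off i) (k + 1)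
          - tailValue Q (fun i => digit m v i + off i) (k + 1))
        linarith
      rw [div_le_iff₀ hmk]
      have h4 : 0 ≤ partialProd Q k * |x| := by positivity
      nlinarith
    set s := |D| / m k
    have hs0 : 0 < s := by positivity
    have hs1 : s ≤ 1 := div_le_one_of_le₀ hDm hmk.le
    have h5 : s ≤ s ^ r := by
      simpa using Real.rpow_le_rpow_of_exponent_ge hs0 hs1 hr1.le
    have h6 : s ^ r ≤ 16 ^ r * ((partialProd Q k : ℝ) ^ r * |x| ^ r) := by
      rw [← Real.mul_rpow (by positivity) (abs_nonneg _),
        ← Real.mul_rpow (by positivity) (by positivity)]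
      exact Real.rpow_le_rpow hs0.le hlow hr0.le
    refine le_of_mul_le_mul_left ?_ (hMpos k)
    calc _ ≤ 2 * (16 ^ r * ((partialProd Q k : ℝ) ^ r * |x| ^ r)) := by linarith
      _ ≤ 2 * (16 ^ r * ((C * partialProd m k) * |x| ^ r)) := by gcongr; exact hC k
      _ = _ := by ring
  · push Not at hex
    -- With all digits equal, u = v: `hC` forces the base-m products to grow at least like 2^{rk},
    -- even though some m_k may equal 1.
    have hb : ∀ k : ℕ, ((2 : ℝ) ^ r) ^ k * |u - v| ≤ C := by
      intro k
      have h1 := hagree k fun i _ => hex i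
      have h2 : partialProd m k * |u - v| ≤ 1 := by
        rw [← Nat.abs_cast, ← abs_mul, h1, abs_le]; constructor <;>
          linarith [T_nonneg m k u, T_lt_one m k u, T_nonneg m k v, T_lt_one m k v]
      have h3 : ((2 : ℝ) ^ r) ^ k ≤ (partialProd Q k : ℝ) ^ r := by
        rw [← Real.rpow_natCast, ← Real.rpow_mul zero_le_two, mul_comm, Real.rpow_mul zero_le_two,
          Real.rpow_natCast]
        exact Real.rpow_le_rpow (by positivity) (by exact_mod_cast two_pow_le_partialProd hQ k)
          hr0.le
      calc _ ≤ C * partialProd m k * |u - v| := by gcongr; exact h3.trans (hC k)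
        _ = C * (partialProd m k * |u - v|) := by ring
        _ ≤ C * 1 := by gcongr
        _ = C := mul_one C
    have h0 : |u - v| = 0 := by
      by_contra hne
      have hpos : 0 < |u - v| := lt_of_le_of_ne (abs_nonneg _) (Ne.symm hne)
      obtain ⟨k, hk⟩ := pow_unbounded_of_one_lt (C / |u - v|)
        (Real.one_lt_rpow one_lt_two hr0)
      rw [div_lt_iff₀ hpos] at hk
      exact absurd (hb k) (not_le.2 hk)
    rw [h0]
    positivity

/-- Once q_k^{1-r} ≥ 8, each factor satisfies q_k^r ≤ m_k, so the ratio stops growing; a sum over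
the initial indices bounds it everywhere. -/
theorem exists_partialProd_rpow_le {Q m : ℕ → ℕ} (hlim : InfiniteInLimit Q)
    (hm : ∀ k, 0 < m k) (hQm : ∀ k, Q k ≤ 8 * m k) {r : ℝ} (hr1 : r < 1) :
    ∃ C : ℝ, ∀ k, (partialProd Q k : ℝ) ^ r ≤ C * partialProd m k := by
  have hMpos : ∀ k, (0 : ℝ) < partialProd m k := fun k => Nat.cast_pos.2 (partialProd_pos hm k)
  set a : ℕ → ℝ := fun k => (partialProd Q k : ℝ) ^ r / partialProd m k
  have ha : ∀ k, 0 ≤ a k := fun k => by positivity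
  have hev : ∀ᶠ k in atTop, (Q k : ℝ) ^ r ≤ m k := by
    have h1 : Tendsto (fun k => (Q k : ℝ) ^ (1 - r)) atTop atTop :=
      (tendsto_rpow_atTop (sub_pos.2 hr1)).comp (tendsto_natCast_atTop_atTop.comp hlim)
    filter_upwards [h1.eventually_ge_atTop 8, hlim.eventually_ge_atTop 1] with k h8 hk
    have hq : (0 : ℝ) < Q k := by exact_mod_cast hk
    have h2 : (Q k : ℝ) ^ r * (Q k : ℝ) ^ (1 - r) = Q k := by
      rw [← Real.rpow_add hq]; simp
    have h3 : (Q k : ℝ) ≤ 8 * m k := by exact_mod_cast hQm k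
    have h4 : 0 ≤ (Q k : ℝ) ^ r := by positivity
    nlinarith
  obtain ⟨N, hN⟩ := eventually_atTop.1 hev
  have hstep : ∀ k, N ≤ k → a k ≤ a N := fun k hk => by
    induction k, hk using Nat.le_induction with
    | base => exact le_rfl
    | succ k hk ih =>
      refine le_trans ?_ ih
      have hmk : (0 : ℝ) < m k := by exact_mod_cast hm k
      simp only [a, partialProd_succ, Nat.cast_mul]
      rw [Real.mul_rpow (by positivity) (by positivity), mul_div_mul_comm]
      exact mul_le_of_le_one_right (ha k) (div_le_one_of_le₀ (hN k hk) hmk.le)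
  refine ⟨∑ k ∈ Finset.range (N + 1), a k, fun k => ?_⟩
  rw [← div_le_iff₀ (hMpos k)]
  have hmem : ∀ i ≤ N, a i ≤ ∑ k ∈ Finset.range (N + 1), a k := fun i hi =>
    Finset.single_le_sum (fun j _ => ha j) (Finset.mem_range.2 (Nat.lt_succ_of_le hi))
  rcases le_total k N with h | h
  · exact hmem k h
  · exact (hstep k h).trans (hmem N le_rfl)

/-- The inverse of g is r-Hölder from the image onto [0, 1), so 1 ≤ dim(image)/r; let r → 1. -/
theorem one_le_dimH_of_forall_holder_inverse {g : ℝ → ℝ} (h : ∀ r : ℝ, 0 < r → r < 1 → ∃ C : ℝ,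
    ∀ u ∈ Set.Ico (0 : ℝ) 1, ∀ v ∈ Set.Ico (0 : ℝ) 1, |u - v| ≤ C * |g u - g v| ^ r) :
    1 ≤ dimH (g '' Set.Ico (0 : ℝ) 1) := by
  have key : ∀ r : NNReal, r < 1 → (r : ENNReal) ≤ dimH (g '' Set.Ico (0 : ℝ) 1) := by
    intro r hr1
    rcases eq_or_ne r 0 with rfl | hr
    · simp
    have hr0 : 0 < r := pos_iff_ne_zero.2 hr
    obtain ⟨C, hC⟩ := h r (by exact_mod_cast hr0) (by exact_mod_cast hr1)
    have hinj : Set.InjOn g (Set.Ico 0 1) := fun u hu v hv huv => by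
      have := hC u hu v hv
      rw [huv, sub_self, abs_zero, Real.zero_rpow (by exact_mod_cast hr), mul_zero] at this
      exact sub_eq_zero.1 (abs_nonpos_iff.1 this)
    set f := Function.invFunOn g (Set.Ico (0 : ℝ) 1)
    have hf : ∀ u ∈ Set.Ico (0 : ℝ) 1, f (g u) = u := hinj.leftInvOn_invFunOn
    have hH : HolderOnWith C.toNNReal r f (g '' Set.Ico 0 1) := by
      rintro _ ⟨u, hu, rfl⟩ _ ⟨v, hv, rfl⟩
      rw [hf u hu, hf v hv, edist_dist, edist_dist, Real.dist_eq, Real.dist_eq,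
        ENNReal.ofReal_rpow_of_nonneg (abs_nonneg _) r.coe_nonneg]
      change _ ≤ ENNReal.ofReal C * _
      rw [← ENNReal.ofReal_mul' (by positivity)]
      exact ENNReal.ofReal_le_ofReal (hC u hu v hv)
    have h1 := hH.dimH_image_le hr0
    rw [Set.LeftInvOn.image_image hf, Real.dimH_of_nonempty_interior (by simp),
      Module.finrank_self, Nat.cast_one] at h1
    rw [ENNReal.le_div_iff_mul_le (by simp [hr]) (by simp), one_mul] at h1
    exact h1
  refine le_of_forall_lt fun c hc => ?_
  lift c to NNReal using hc.ne_top
  obtain ⟨r, hcr, hr⟩ := exists_between hc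
  lift r to NNReal using hr.ne_top
  exact hcr.trans_le (key r (by exact_mod_cast hr))

/-! ### Oscillating frequencies and the conclusion. -/

theorem countIn_succ_of_mem {I : Set ℝ} {ω : ℕ → ℝ} {n : ℕ} (h : ω n ∈ I) :
    countIn I ω (n + 1) = countIn I ω n + 1 := by
  classical
  simp [countIn, Finset.range_add_one, Finset.filter_insert, h]

theorem countIn_succ_of_notMem {I : Set ℝ} {ω : ℕ → ℝ} {n : ℕ} (h : ω n ∉ I) :
    countIn I ω (n + 1) = countIn I ω n := by
  classical
  simp [countIn, Finset.range_add_one, Finset.filter_insert, h]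

theorem countIn_of_forall_mem {I : Set ℝ} {ω : ℕ → ℝ} {a b : ℕ} (hab : a ≤ b)
    (h : ∀ n, a ≤ n → n < b → ω n ∈ I) : countIn I ω b + a = countIn I ω a + b := by
  induction b, hab using Nat.le_induction with
  | base => rfl
  | succ b hb ih =>
    rw [countIn_succ_of_mem (h b hb b.lt_succ_self)]
    have := ih fun n h1 h2 => h n h1 (h2.trans b.lt_succ_self)
    omega

theorem countIn_of_forall_notMem {I : Set ℝ} {ω : ℕ → ℝ} {a b : ℕ} (hab : a ≤ b)
    (h : ∀ n, a ≤ n → n < b → ω n ∉ I) : countIn I ω b = countIn I ω a := by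
  induction b, hab using Nat.le_induction with
  | base => rfl
  | succ b hb ih =>
    rw [countIn_succ_of_notMem (h b hb b.lt_succ_self)]
    exact ih fun n h1 h2 => h n h1 (h2.trans b.lt_succ_self)

/-- Compare frequencies at successive powers of 2: a full block gives L = L/2 + 1/2, an empty one L
= L/2, a contradiction. -/
theorem not_tendsto_of_even_log {I : Set ℝ} {ω : ℕ → ℝ} {N : ℕ}
    (h : ∀ n ≥ N, ω n ∈ I ↔ Even (Nat.log 2 n)) (L : ℝ) :
    ¬ Tendsto (fun n : ℕ => (countIn I ω n : ℝ) / n) atTop (𝓝 L) := by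
  intro hL
  have hlog : ∀ j n : ℕ, 2 ^ j ≤ n → n < 2 ^ (j + 1) → Nat.log 2 n = j := fun j n h1 h2 =>
    Nat.log_eq_of_pow_le_of_lt_pow h1 h2
  have hN : ∀ j ≥ N, N ≤ 2 ^ j := fun j hj => hj.trans Nat.lt_two_pow_self.le
  have hpow : ∀ j : ℕ, (2 : ℕ) ^ j ≤ 2 ^ (j + 1) := fun j => Nat.pow_le_pow_right two_pos j.le_succ
  have hsub : ∀ s : ℕ → ℕ, Tendsto s atTop atTop →
      Tendsto (fun j => (countIn I ω (2 ^ s j) : ℝ) / (2 ^ s j : ℕ)) atTop (𝓝 L) := fun s hs =>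
    hL.comp ((tendsto_pow_atTop_atTop_of_one_lt one_lt_two).comp hs)
  have t0 : Tendsto (fun j : ℕ => 2 * j) atTop atTop := tendsto_id.const_mul_atTop' two_pos
  have t1 : Tendsto (fun j : ℕ => 2 * j + 1) atTop atTop := (tendsto_add_atTop_nat 1).comp t0
  have t2 : Tendsto (fun j : ℕ => 2 * j + 1 + 1) atTop atTop := (tendsto_add_atTop_nat 1).comp t1
  have hL1 : L = L / 2 + 1 / 2 := by
    refine tendsto_nhds_unique (hsub _ t1) ((((hsub _ t0).div_const 2).add_const (1 / 2)).congr' ?_)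
    filter_upwards [eventually_ge_atTop N] with j hj
    have := countIn_of_forall_mem (hpow (2 * j)) (I := I) (ω := ω) fun n h1 h2 =>
      (h n ((hN (2 * j) (by omega)).trans h1)).2 (by rw [hlog _ n h1 h2]; simp)
    have e : (countIn I ω (2 ^ (2 * j + 1)) : ℝ) = countIn I ω (2 ^ (2 * j)) + 2 ^ (2 * j) := by
      rw [pow_succ] at this ⊢
      have : countIn I ω (2 ^ (2 * j) * 2) = countIn I ω (2 ^ (2 * j)) + 2 ^ (2 * j) := by omega
      exact_mod_cast this
    rw [e]
    push_cast
    rw [pow_succ]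
    field_simp
  have hL0 : L = L / 2 := by
    refine tendsto_nhds_unique (hsub _ t2) (((hsub _ t1).div_const 2).congr' ?_)
    filter_upwards [eventually_ge_atTop N] with j hj
    have := countIn_of_forall_notMem (hpow (2 * j + 1)) (I := I) (ω := ω) fun n h1 h2 hmem => by
      have := (h n ((hN (2 * j + 1) (by omega)).trans h1)).1 hmem
      rw [hlog _ n h1 h2] at this
      simp at this
    rw [this]
    push_cast
    rw [pow_succ 2 (2 * j + 1)]
    field_simp
  linarith

/-- The number of digits allowed at index `k`. -/
def digitCount (Q : ℕ → ℕ) (k : ℕ) : ℕ := max 1 (Q k / 4)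

/-- The least digit allowed at index `k`. -/
def digitOffset (Q : ℕ → ℕ) (k : ℕ) : ℕ := if Even (Nat.log 2 k) then 0 else Q k / 2

theorem transfer_mem_noADFSet {Q : ℕ → ℕ} (hQ : IsBasicSequence Q) (hlim : InfiniteInLimit Q)
    (u : ℝ) : transfer Q (digitCount Q) (digitOffset Q) u ∈ noADFSet Q := by
  rintro ⟨f, -, hf⟩
  obtain ⟨N, hN⟩ := eventually_atTop.1 (hlim.eventually_ge_atTop 4)
  set e : ℕ → ℕ := fun k => digit (digitCount Q) u k + digitOffset Q k with hedef
  have hd : ∀ k, digit (digitCount Q) u k < digitCount Q k := fun k =>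
    digit_lt (by simp [digitCount]) u
  have he : ∀ k, e k < Q k := fun k => by
    have h1 := hd k
    have h2 := hQ k
    simp only [hedef, digitCount, digitOffset] at h1 ⊢
    split_ifs <;> omega
  -- For q_n ≥ 4 the low digits give T_n ≤ 1/4. The high ones give T_n ≥ ⌊q_n/2⌋/q_n ≥ 2/5, with
  -- equality in the last bound at q_n = 5. The threshold 1/3 separates them.
  refine not_tendsto_of_even_log (N := N) (fun n hn => ?_) _ (hf ⟨1 / 3, by norm_num, by norm_num⟩)
  have hq4 := hN n hn
  have hq : (0 : ℝ) < Q n := by exact_mod_cast (show 0 < Q n by omega)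
  have h1 := mul_tailValue hQ he n
  have h2 := tailValue_nonneg Q e (n + 1)
  have h3 := tailValue_le_one hQ he (n + 1)
  have hdn := hd n
  have hlt : tailValue Q e n < 1 := by
    have : 4 * (e n + 1) ≤ 3 * Q n := by
      simp only [hedef, digitCount, digitOffset] at hdn ⊢
      split_ifs <;> omega
    have h4 : 4 * ((e n : ℝ) + 1) ≤ 3 * Q n := by exact_mod_cast this
    nlinarith
  have hT : T Q n (transfer Q (digitCount Q) (digitOffset Q) u) = tailValue Q e n :=
    T_seriesValue hQ he hlt
  simp only [hT, Set.mem_Ico, tailValue_nonneg, true_and]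
  constructor
  · intro h
    by_contra hodd
    have : 2 * Q n ≤ 5 * e n := by
      simp only [hedef, digitOffset, if_neg hodd]
      omega
    have h4 : 2 * (Q n : ℝ) ≤ 5 * e n := by exact_mod_cast this
    nlinarith
  · intro heven
    have : 4 * (e n + 1) ≤ Q n := by
      simp only [hedef, digitCount, digitOffset, if_pos heven] at hdn ⊢
      omega
    have h4 : 4 * ((e n : ℝ) + 1) ≤ Q n := by exact_mod_cast this
    nlinarith

theorem dimH_noADFSet {Q : ℕ → ℕ} (hQ : IsBasicSequence Q) (hlim : InfiniteInLimit Q) :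
    dimH (noADFSet Q) = 1 := by
  refine le_antisymm ((dimH_mono (Set.subset_univ _)).trans_eq Real.dimH_univ) ?_
  have hsub : transfer Q (digitCount Q) (digitOffset Q) '' Set.Ico 0 1 ⊆ noADFSet Q := by
    rintro _ ⟨u, -, rfl⟩
    exact transfer_mem_noADFSet hQ hlim u
  refine (one_le_dimH_of_forall_holder_inverse fun r hr0 hr1 => ?_).trans (dimH_mono hsub)
  have hm : ∀ k, 0 < digitCount Q k := fun k => by simp [digitCount]
  -- The constant 8 absorbs the floor in `Q k / 4`; the tightest case is `Q k = 7` with one digit.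
  have hQm : ∀ k, Q k ≤ 8 * digitCount Q k := fun k => by simp only [digitCount]; omega
  obtain ⟨C, hC⟩ := exists_partialProd_rpow_le hlim hm hQm hr1
  refine ⟨2 * C * 16 ^ r, fun u hu v hv => abs_sub_le_transfer hQ hm (fun k => ?_) hQm
    (fun k => ?_) hr0 hr1 hC hu hv⟩
  · have := hQ k
    simp only [digitCount]; omega
  · have := hQ k
    simp only [digitCount, digitOffset]
    split_ifs <;> omega

end CantorSeries

theorem mainTheorem3 (Q : ℕ → ℕ) (hQ : CantorSeries.IsBasicSequence Q)
    (hlim : CantorSeries.InfiniteInLimit Q) :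
    volume (CantorSeries.noADFSet Q) = 0 ∧ dimH (CantorSeries.noADFSet Q) = 1 :=
  ⟨CantorSeries.volume_noADFSet hQ, CantorSeries.dimH_noADFSet hQ hlim⟩
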